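/- All spaces are assumed to be Tychonoff (completely regular and Hausdorff). A family $\mathcal U$ of open subsets of a space $X$ is an outer base of $A\subseteq X$ if $A\subseteq U$ for all $U\in\mathcal U$ and every open $O\supseteq A$ contains some $U\in\mathcal U$. A topological group is feathered if it contains a non-empty compact subspace with a countable outer base. A space $X$ is Čech-complete if it is a $G_\delta$-subset of its Stone–Čech compactification $\beta X$. Let $G$ be a feathered (Hausdorff) topological group. Then the following conditions are equivalent: (1) $G$ is Čech-complete; (2) every closed subgroup $G_0$ of $G$ admitting a dense $\sigma$-compact subspace is Čech-complete; (3) there exists a compact subgroup $H$ of $G$ with a countable outer base in $G$ such that $\overline{\langle QH\rangle}$ is Čech-complete for every countable $Q\subseteq G$, where $\langle X\rangle$ denotes the smallest subgroup of $G$ containing $X\subseteq G$. -/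

import Mathlib

open scoped Pointwise

/-- A family `𝒰` of open sets is an outer base for `A` if every member contains `A` and
every open set containing `A` contains a member of `𝒰`. -/
def IsOuterBase {X : Type*} [TopologicalSpace X] (𝒰 : Set (Set X)) (A : Set X) : Prop :=
  (∀ U ∈ 𝒰, IsOpen U ∧ A ⊆ U) ∧ ∀ O : Set X, IsOpen O → A ⊆ O → ∃ U ∈ 𝒰, U ⊆ O

/-- The set `A` has a countable outer base in `X`. -/
def HasCountableOuterBase {X : Type*} [TopologicalSpace X] (A : Set X) : Prop :=
  ∃ 𝒰 : Set (Set X), 𝒰.Countable ∧ IsOuterBase 𝒰 A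

/-- A topological group is feathered if it contains a non-empty compact subspace with
a countable outer base. -/
def IsFeathered (G : Type*) [TopologicalSpace G] [Group G] : Prop :=
  ∃ K : Set G, K.Nonempty ∧ IsCompact K ∧ HasCountableOuterBase K

/-- A space is Čech-complete if it is Tychonoff and a `Gδ` subset of its Stone–Čech
compactification. -/
def IsCechComplete (X : Type*) [TopologicalSpace X] : Prop :=
  T35Space X ∧ IsGδ (Set.range (stoneCechUnit : X → StoneCech X))

open Topology Filter Set

/-! Everything passes through Raikov completeness. A Čech-complete group is Baire, so a generic
right translate of a Raikov-Cauchy ultrafilter meets all the covers that witness completeness, and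
hence converges. Conversely, compactness of a subgroup `H` with a countable outer base makes an
ultrafilter Cauchy once it is small modulo each outer-base member, so Raikov completeness gives back
suitable covers.

Only countably many conditions are involved: a Cauchy ultrafilter yields points `x n`, one per
outer-base member, and its thickening traces on the closed subgroup generated by the `x n * H`. A
limit there is a limit of the ultrafilter, whence 3 → 1. For 2 → 3, a feathered group has such an
`H`, and countably many cosets of it generate a σ-compact subgroup; 1 → 2 is closed heredity. -/

/-! ### Čech-completeness through open covers, and the Baire property -/

/-- A sequence of open covers such that every ultrafilter meeting all of them converges. -/
def HasCompleteCovers (X : Type*) [TopologicalSpace X] : Prop :=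
  ∃ 𝒰 : ℕ → Set (Set X), (∀ n, ∀ U ∈ 𝒰 n, IsOpen U) ∧ (∀ n x, ∃ U ∈ 𝒰 n, x ∈ U) ∧
    ∀ u : Ultrafilter X, (∀ n, ∃ U ∈ 𝒰 n, U ∈ u) → ∃ x, (u : Filter X) ≤ 𝓝 x

/-- Closures inside `W n` force the limit in the compactification into every `W n`, hence into the
space. -/
theorem IsCechComplete.hasCompleteCovers {X : Type*} [TopologicalSpace X]
    (h : IsCechComplete X) : HasCompleteCovers X := by
  obtain ⟨hT, hG⟩ := h
  obtain ⟨W, hWo, hW⟩ := isGδ_iff_eq_iInter_nat.1 hG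
  refine ⟨fun n ↦ {V | ∃ O, IsOpen O ∧ closure O ⊆ W n ∧ V = stoneCechUnit ⁻¹' O}, ?_, ?_, ?_⟩
  · rintro n _ ⟨O, hO, -, rfl⟩
    exact hO.preimage continuous_stoneCechUnit
  · intro n x
    have hx : stoneCechUnit x ∈ W n := by
      have : stoneCechUnit x ∈ range (stoneCechUnit : X → StoneCech X) := mem_range_self x
      rw [hW] at this
      exact mem_iInter.1 this n
    obtain ⟨C, hC, hCc, hCW⟩ := exists_mem_nhds_isClosed_subset ((hWo n).mem_nhds hx)
    exact ⟨_, ⟨interior C, isOpen_interior, (closure_minimal interior_subset hCc).trans hCW, rfl⟩,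
      mem_interior_iff_mem_nhds.2 hC⟩
  · intro u hu
    obtain ⟨p, -, hp⟩ := isCompact_univ.ultrafilter_le_nhds
      (u.map (stoneCechUnit : X → StoneCech X)) (by simp)
    have hpr : p ∈ range (stoneCechUnit : X → StoneCech X) := by
      rw [hW]
      refine mem_iInter.2 fun n ↦ ?_
      obtain ⟨_, ⟨O, -, hOW, rfl⟩, hOu⟩ := hu n
      exact hOW (mem_closure_iff_ultrafilter.2 ⟨_, hOu, hp⟩)
    obtain ⟨x, rfl⟩ := hpr
    refine ⟨x, ?_⟩
    rw [isInducing_stoneCechUnit.nhds_eq_comap, ← map_le_iff_le_comap]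
    exact hp

theorem HasCompleteCovers.isCechComplete {X : Type*} [TopologicalSpace X] [T35Space X]
    (h : HasCompleteCovers X) : IsCechComplete X := by
  obtain ⟨𝒰, ho, hc, hu⟩ := h
  refine ⟨inferInstance, isGδ_iff_eq_iInter_nat.2
    ⟨fun n ↦ ⋃₀ {O | IsOpen O ∧ ∃ U ∈ 𝒰 n, stoneCechUnit ⁻¹' O ⊆ U},
      fun n ↦ isOpen_sUnion fun O hO ↦ hO.1, ?_⟩⟩
  apply Subset.antisymm
  · rintro _ ⟨x, rfl⟩
    refine mem_iInter.2 fun n ↦ ?_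
    obtain ⟨U, hU, hxU⟩ := hc n x
    obtain ⟨O, hO, rfl⟩ := isInducing_stoneCechUnit.isOpen_iff.1 (ho n U hU)
    exact ⟨O, ⟨hO, _, hU, Subset.rfl⟩, hxU⟩
  · intro p hp
    have : NeBot (comap (stoneCechUnit : X → StoneCech X) (𝓝 p)) :=
      isDenseInducing_stoneCechUnit.comap_nhds_neBot p
    have hle : ((Ultrafilter.of (comap (stoneCechUnit : X → StoneCech X) (𝓝 p)) :
        Ultrafilter X) : Filter X) ≤ comap stoneCechUnit (𝓝 p) := Ultrafilter.of_le _
    generalize Ultrafilter.of (comap (stoneCechUnit : X → StoneCech X) (𝓝 p)) = v at hle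
    obtain ⟨x, hx⟩ := hu v fun n ↦ by
      obtain ⟨O, ⟨hO, U, hU, hOU⟩, hpO⟩ := mem_iInter.1 hp n
      exact ⟨U, hU, mem_of_superset (hle (preimage_mem_comap (hO.mem_nhds hpO))) hOU⟩
    refine ⟨x, tendsto_nhds_unique (f := stoneCechUnit) (l := (v : Filter X)) ?_ ?_⟩
    · exact continuous_stoneCechUnit.continuousAt.mono_left hx
    · exact map_le_iff_le_comap.2 hle

theorem HasCompleteCovers.of_isClosedEmbedding {X Y : Type*} [TopologicalSpace X]
    [TopologicalSpace Y] {f : Y → X} (hf : IsClosedEmbedding f) (h : HasCompleteCovers X) :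
    HasCompleteCovers Y := by
  obtain ⟨𝒰, ho, hc, hu⟩ := h
  refine ⟨fun n ↦ preimage f '' 𝒰 n, ?_, ?_, ?_⟩
  · rintro n _ ⟨U, hU, rfl⟩
    exact (ho n U hU).preimage hf.continuous
  · intro n y
    obtain ⟨U, hU, hy⟩ := hc n (f y)
    exact ⟨_, mem_image_of_mem _ hU, hy⟩
  · intro v hv
    obtain ⟨x, hx⟩ := hu (v.map f) fun n ↦ by
      obtain ⟨_, ⟨U, hU, rfl⟩, hUv⟩ := hv n
      exact ⟨U, hU, hUv⟩
    obtain ⟨y, rfl⟩ : x ∈ range f :=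
      hf.isClosed_range.mem_of_tendsto (b := (v : Filter Y)) hx (Eventually.of_forall mem_range_self)
    refine ⟨y, ?_⟩
    rw [hf.isInducing.nhds_eq_comap, ← map_le_iff_le_comap]
    exact hx

/-- Baire category is applied in the compactification to `O n ∩ W n`; the `W n` bring the resulting
point back into the space. -/
theorem IsCechComplete.baireSpace {X : Type*} [TopologicalSpace X] (h : IsCechComplete X) :
    BaireSpace X := by
  obtain ⟨hT, hG⟩ := h
  obtain ⟨W, hWo, hW⟩ := isGδ_iff_eq_iInter_nat.1 hG
  have hWr (n : ℕ) : range stoneCechUnit ⊆ W n := hW ▸ iInter_subset W n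
  refine ⟨fun f hfo hfd ↦ ?_⟩
  choose O hO hOf using fun n ↦ isInducing_stoneCechUnit.isOpen_iff.1 (hfo n)
  have hOd (n : ℕ) : Dense (O n) :=
    (denseRange_stoneCechUnit.dense_image continuous_stoneCechUnit (hfd n)).mono <| by
      rw [← hOf n]
      exact image_preimage_subset _ _
  have hd : Dense (⋂ n, O n ∩ W n) := dense_iInter_of_isOpen_nat
    (fun n ↦ (hO n).inter (hWo n))
    fun n ↦ (hOd n).inter_of_isOpen_left (denseRange_stoneCechUnit.mono (hWr n)) (hO n)
  refine dense_iff_inter_open.2 fun U hU hne ↦ ?_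
  obtain ⟨U', hU', rfl⟩ := isInducing_stoneCechUnit.isOpen_iff.1 hU
  obtain ⟨p, hpU, hp⟩ := hd.inter_open_nonempty U' hU' (hne.elim fun x hx ↦ ⟨_, hx⟩)
  rw [mem_iInter] at hp
  obtain ⟨x, rfl⟩ : p ∈ range stoneCechUnit := hW ▸ mem_iInter.2 fun n ↦ (hp n).2
  refine ⟨x, hpU, mem_iInter.2 fun n ↦ ?_⟩
  rw [← hOf n]
  exact (hp n).1

/-! ### Raikov completeness and Čech-completeness -/

section Groups

variable {G : Type*} [TopologicalSpace G] [Group G]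

/-- Cauchy filters for the two-sided (Raikov) uniformity of a topological group. -/
def IsRaikovCauchy (F : Filter G) : Prop :=
  ∀ U ∈ 𝓝 (1 : G), ∃ A ∈ F, ∀ a ∈ A, ∀ b ∈ A, a⁻¹ * b ∈ U ∧ a * b⁻¹ ∈ U

variable [IsTopologicalGroup G]

theorem t35Space_of_isTopologicalGroup [T2Space G] : T35Space G :=
  let _ : UniformSpace G := IsTopologicalGroup.rightUniformSpace G
  { }

/-- A Raikov-Cauchy ultrafilter can be translated so that it meets a sequence of open covers. -/
theorem exists_mul_right_mem_covers [BaireSpace G] {𝒰 : ℕ → Set (Set G)}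
    (ho : ∀ n, ∀ U ∈ 𝒰 n, IsOpen U) (hc : ∀ n x, ∃ U ∈ 𝒰 n, x ∈ U)
    {u : Ultrafilter G} (hu : IsRaikovCauchy (u : Filter G)) :
    ∃ g : G, ∀ n, ∃ U ∈ 𝒰 n, U ∈ u.map (· * g) := by
  set D : ℕ → Set G := fun n ↦ interior {g | ∃ U ∈ 𝒰 n, U ∈ u.map (· * g)} with hD
  have hDd (n : ℕ) : Dense (D n) := by
    refine dense_iff_inter_open.2 fun N hN ⟨g, hg⟩ ↦ ?_
    have hNg : (· * g) ⁻¹' N ∈ 𝓝 (1 : G) :=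
      (hN.preimage (continuous_mul_const g)).mem_nhds (by simpa using hg)
    obtain ⟨A, hA, hAN⟩ := hu _ hNg
    obtain ⟨a, ha⟩ := u.nonempty_of_mem hA
    obtain ⟨W, hW, haW⟩ := hc n (a * g)
    have hcont : Continuous fun p : G × G ↦ p.1 * (a * g) * p.2 := by fun_prop
    have hPQ : (fun p : G × G ↦ p.1 * (a * g) * p.2) ⁻¹' W ∈ 𝓝 ((1 : G), (1 : G)) :=
      ((ho n W hW).preimage hcont).mem_nhds (by simpa using haW)
    obtain ⟨P, hP, Q, hQ, hPQW⟩ := mem_nhds_prod_iff.1 hPQ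
    obtain ⟨B, hB, hBP⟩ := hu P hP
    obtain ⟨b, hb⟩ := u.nonempty_of_mem (inter_mem hA hB)
    -- Since `y * (b⁻¹ * a * g) = (y * b⁻¹) * (a * g)`, this translation sends `u`-most points near
    -- `a * g`, while smallness of `b⁻¹ * a` keeps it in `N`.
    refine ⟨b⁻¹ * a * g, (hAN b hb.1 a ha).1, mem_interior_iff_mem_nhds.2 ?_⟩
    have hQ' : (fun x ↦ (b⁻¹ * a * g)⁻¹ * x) ⁻¹' Q ∈ 𝓝 (b⁻¹ * a * g) :=
      (continuous_const_mul _).continuousAt.preimage_mem_nhds (by rwa [inv_mul_cancel])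
    refine mem_of_superset hQ' fun x hx ↦ ⟨W, hW, ?_⟩
    refine Ultrafilter.mem_map.2 (mem_of_superset hB fun y hy ↦ ?_)
    have := hPQW (mk_mem_prod (hBP y hy b hb.2).2 hx)
    simpa [mul_assoc] using this
  obtain ⟨g, hg⟩ := (dense_iInter_of_isOpen_nat (fun n ↦ isOpen_interior) hDd).nonempty
  refine ⟨g, fun n ↦ ?_⟩
  have hgn : g ∈ D n := mem_iInter.1 hg n
  exact (interior_subset hgn : g ∈ {g | ∃ U ∈ 𝒰 n, U ∈ u.map (· * g)})

theorem IsCechComplete.exists_le_nhds_of_isRaikovCauchy (h : IsCechComplete G)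
    {u : Ultrafilter G} (hu : IsRaikovCauchy (u : Filter G)) : ∃ x, (u : Filter G) ≤ 𝓝 x := by
  have := h.baireSpace
  obtain ⟨𝒰, ho, hc, hconv⟩ := h.hasCompleteCovers
  obtain ⟨g, hg⟩ := exists_mul_right_mem_covers ho hc hu
  obtain ⟨y, hy⟩ := hconv _ hg
  refine ⟨y * g⁻¹, ?_⟩
  have ht : Tendsto (· * g) (u : Filter G) (𝓝 y) := hy
  simpa [Tendsto] using (ht.mul_const g⁻¹)

theorem HasCountableOuterBase.exists_nat {X : Type*} [TopologicalSpace X] {K : Set X}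
    (h : HasCountableOuterBase K) : ∃ U : ℕ → Set X, (∀ n, IsOpen (U n)) ∧ (∀ n, K ⊆ U n) ∧
      ∀ O, IsOpen O → K ⊆ O → ∃ n, U n ⊆ O := by
  obtain ⟨𝒰, hc, hU, hO⟩ := h
  obtain ⟨V, hV, -⟩ := hO univ isOpen_univ (subset_univ _)
  obtain ⟨U, rfl⟩ := hc.exists_eq_range ⟨V, hV⟩
  exact ⟨U, fun n ↦ (hU _ (mem_range_self n)).1, fun n ↦ (hU _ (mem_range_self n)).2,
    fun O h₁ h₂ ↦ by simpa using hO O h₁ h₂⟩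

theorem hasCountableOuterBase_of_nat {X : Type*} [TopologicalSpace X] {K : Set X}
    {U : ℕ → Set X} (ho : ∀ n, IsOpen (U n)) (hK : ∀ n, K ⊆ U n)
    (hU : ∀ O, IsOpen O → K ⊆ O → ∃ n, U n ⊆ O) : HasCountableOuterBase K := by
  refine ⟨range U, countable_range U, ?_, fun O h₁ h₂ ↦ by simpa using hU O h₁ h₂⟩
  rintro _ ⟨n, rfl⟩
  exact ⟨ho n, hK n⟩

theorem exists_mem_nhds_one_inv_mul_subset {U : Set G} (hU : U ∈ 𝓝 (1 : G)) :
    ∃ O, IsOpen O ∧ 1 ∈ O ∧ ∀ a ∈ O, ∀ b ∈ O, a⁻¹ * b ∈ U ∧ a * b⁻¹ ∈ U := by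
  have hc : ContinuousAt (fun p : G × G ↦ (p.1⁻¹ * p.2, p.1 * p.2⁻¹)) (1, 1) := by fun_prop
  have hmem : (fun p : G × G ↦ (p.1⁻¹ * p.2, p.1 * p.2⁻¹)) ⁻¹' (U ×ˢ U) ∈ 𝓝 ((1 : G), (1 : G)) :=
    hc.preimage_mem_nhds (by simpa using prod_mem_nhds hU hU)
  rw [nhds_prod_eq, mem_prod_same_iff] at hmem
  obtain ⟨t, ht, htU⟩ := hmem
  obtain ⟨O, hOt, hO, h1⟩ := mem_nhds_iff.1 ht
  exact ⟨O, hO, h1, fun a ha b hb ↦ htU (mk_mem_prod (hOt ha) (hOt hb))⟩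

/-- Smallness modulo a compact set with the outer base `U` forces an ultrafilter to be Cauchy. -/
theorem isRaikovCauchy_of_outerBase {K : Set G} (hK : IsCompact K) {U : ℕ → Set G}
    (hU : ∀ O, IsOpen O → K ⊆ O → ∃ n, U n ⊆ O) {u : Ultrafilter G}
    (hu : ∀ n, ∃ A ∈ u, ∀ a ∈ A, ∀ b ∈ A, a⁻¹ * b ∈ U n ∧ a * b⁻¹ ∈ U n) :
    IsRaikovCauchy (u : Filter G) := by
  intro V hV
  obtain ⟨O, hO, h1, hOV⟩ := exists_mem_nhds_one_inv_mul_subset hV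
  have left : ∃ A ∈ u, ∀ a ∈ A, ∀ b ∈ A, a⁻¹ * b ∈ V := by
    obtain ⟨t, ht⟩ := hK.elim_finite_subcover (fun k : G ↦ (k⁻¹ * ·) ⁻¹' O)
      (fun k ↦ hO.preimage (continuous_const_mul _)) fun k _ ↦ mem_iUnion.2 ⟨k, by simpa using h1⟩
    obtain ⟨n, hn⟩ := hU _ (isOpen_biUnion fun k _ ↦ hO.preimage (continuous_const_mul _)) ht
    obtain ⟨A, hA, hAU⟩ := hu n
    obtain ⟨a, ha⟩ := u.nonempty_of_mem hA
    have hmem : (⋃ k ∈ t, {x | k⁻¹ * (a⁻¹ * x) ∈ O}) ∈ u :=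
      mem_of_superset hA fun x hx ↦ by simpa using hn (hAU a ha x hx).1
    -- The ultrafilter selects one of finitely many small translates: smallness modulo `K` becomes
    -- genuine smallness.
    obtain ⟨k, -, hk⟩ := (Ultrafilter.finite_biUnion_mem_iff t.finite_toSet).1 hmem
    refine ⟨_, hk, fun x hx y hy ↦ ?_⟩
    simpa [mul_assoc] using (hOV _ hx _ hy).1
  have right : ∃ A ∈ u, ∀ a ∈ A, ∀ b ∈ A, a * b⁻¹ ∈ V := by
    obtain ⟨t, ht⟩ := hK.elim_finite_subcover (fun k : G ↦ (· * k⁻¹) ⁻¹' (O⁻¹ : Set G))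
      (fun k ↦ hO.inv.preimage (continuous_mul_const _))
      fun k _ ↦ mem_iUnion.2 ⟨k, by simpa using h1⟩
    obtain ⟨n, hn⟩ := hU _ (isOpen_biUnion fun k _ ↦ hO.inv.preimage (continuous_mul_const _)) ht
    obtain ⟨A, hA, hAU⟩ := hu n
    obtain ⟨a, ha⟩ := u.nonempty_of_mem hA
    have hmem : (⋃ k ∈ t, {x | (x * a⁻¹ * k⁻¹)⁻¹ ∈ O}) ∈ u :=
      mem_of_superset hA fun x hx ↦ by simpa using hn (hAU x hx a ha).2
    obtain ⟨k, -, hk⟩ := (Ultrafilter.finite_biUnion_mem_iff t.finite_toSet).1 hmem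
    refine ⟨_, hk, fun x hx y hy ↦ ?_⟩
    simpa [mul_assoc] using (hOV _ hx _ hy).1
  obtain ⟨A, hA, hAV⟩ := left
  obtain ⟨B, hB, hBV⟩ := right
  exact ⟨A ∩ B, inter_mem hA hB, fun a ha b hb ↦ ⟨hAV a ha.1 b hb.1, hBV a ha.2 b hb.2⟩⟩

/-- A group with a compact subset of countable character at the identity is Čech-complete as soon
as it is Raikov complete. -/
theorem isCechComplete_of_isRaikovCauchy [T2Space G] {K : Set G} (hK : IsCompact K)
    (h1 : 1 ∈ K) (hKb : HasCountableOuterBase K)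
    (h : ∀ u : Ultrafilter G, IsRaikovCauchy (u : Filter G) → ∃ x, (u : Filter G) ≤ 𝓝 x) :
    IsCechComplete G := by
  have := t35Space_of_isTopologicalGroup (G := G)
  obtain ⟨U, hUo, hKU, hU⟩ := hKb.exists_nat
  refine HasCompleteCovers.isCechComplete
    ⟨fun n ↦ {A | IsOpen A ∧ ∀ a ∈ A, ∀ b ∈ A, a⁻¹ * b ∈ U n ∧ a * b⁻¹ ∈ U n},
      fun n A hA ↦ hA.1, fun n x ↦ ?_, fun u hu ↦ h u (isRaikovCauchy_of_outerBase hK hU ?_)⟩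
  · obtain ⟨O, hO, h1O, hOU⟩ :=
      exists_mem_nhds_one_inv_mul_subset ((hUo n).mem_nhds (hKU n h1))
    refine ⟨(x⁻¹ * ·) ⁻¹' O ∩ (· * x⁻¹) ⁻¹' O, ⟨(hO.preimage (continuous_const_mul _)).inter
      (hO.preimage (continuous_mul_const _)), fun a ha b hb ↦ ⟨?_, ?_⟩⟩, by simpa using h1O⟩
    · simpa [mul_assoc] using (hOU _ ha.1 _ hb.1).1
    · simpa [mul_assoc] using (hOU _ ha.2 _ hb.2).2
  · intro n
    obtain ⟨A, hA, hAu⟩ := hu n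
    exact ⟨A, hAu, hA.2⟩

/-! ### Reduction to subgroups with countably many generators modulo `H` -/

/-- Thickening by the neighbourhoods of the identity preserves Raikov-Cauchy filters. -/
theorem IsRaikovCauchy.mul_nhds_one {F : Filter G} [NeBot F] (hF : IsRaikovCauchy F) :
    IsRaikovCauchy (F * 𝓝 1) := by
  intro U hU
  have hl : (fun p : G × G × G ↦ p.1⁻¹ * p.2.1 * p.2.2) ⁻¹' U ∈ 𝓝 ((1 : G), (1 : G), (1 : G)) :=
    ContinuousAt.preimage_mem_nhds (by fun_prop) (by simpa using hU)
  have hr : (fun p : G × G × G ↦ p.1 * p.2.1 * p.2.2) ⁻¹' U ∈ 𝓝 ((1 : G), (1 : G), (1 : G)) :=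
    ContinuousAt.preimage_mem_nhds (by fun_prop) (by simpa using hU)
  simp only [nhds_prod_eq] at hl hr
  obtain ⟨W₁, hW₁, R₁, hR₁, hl⟩ := mem_prod_iff.1 (inter_mem hl hr)
  obtain ⟨W₂, hW₂, W₃, hW₃, hR⟩ := mem_prod_iff.1 hR₁
  obtain ⟨A, hA, hAW⟩ := hF _ (inter_mem (inter_mem hW₁ hW₂) hW₃)
  obtain ⟨c, hc⟩ := Filter.nonempty_of_mem hA
  -- One fixed `c` controls the conjugation: `a p q⁻¹ b⁻¹ = (a c⁻¹)(c p q⁻¹ c⁻¹)(c b⁻¹)`.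
  have hE : (fun p : G × G ↦ c * (p.1 * p.2⁻¹) * c⁻¹) ⁻¹' W₂ ∈ 𝓝 ((1 : G), (1 : G)) :=
    ContinuousAt.preimage_mem_nhds (by fun_prop) (by simpa using hW₂)
  rw [nhds_prod_eq, mem_prod_same_iff] at hE
  obtain ⟨E, hE, hEW⟩ := hE
  refine ⟨A * (E ∩ W₁ ∩ W₃), mul_mem_mul hA (inter_mem (inter_mem hE hW₁) hW₃), ?_⟩
  rintro _ ⟨a, ha, p, ⟨⟨hpE, hp₁⟩, hp₃⟩, rfl⟩ _ ⟨b, hb, q, ⟨⟨hqE, hq₁⟩, hq₃⟩, rfl⟩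
  have h₁ := (hl (mk_mem_prod hp₁ (hR (mk_mem_prod (hAW a ha b hb).1.1.2 hq₃)))).1
  have h₂ := (hl (mk_mem_prod (hAW a ha c hc).2.1.1
    (hR (mk_mem_prod (hEW (mk_mem_prod hpE hqE)) (hAW c hc b hb).2.2)))).2
  simp only [mem_preimage, mul_assoc, inv_mul_cancel_left] at h₁ h₂
  simpa [mul_assoc] using And.intro h₁ h₂

/-- If suitable closed subgroups of a group of countable pointwise type are Čech-complete, then
Raikov-Cauchy ultrafilters converge. -/
theorem exists_le_nhds_of_isCechComplete_closure {H : Subgroup G}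
    (hHb : HasCountableOuterBase (H : Set G))
    (h : ∀ Q : Set G, Q.Countable →
      IsCechComplete (Subgroup.closure (Q * (H : Set G))).topologicalClosure)
    {u : Ultrafilter G} (hu : IsRaikovCauchy (u : Filter G)) : ∃ x, (u : Filter G) ≤ 𝓝 x := by
  obtain ⟨U, hUo, hHU, hU⟩ := hHb.exists_nat
  choose A hA hAU using fun n ↦ hu (U n) ((hUo n).mem_nhds (hHU n H.one_mem))
  choose x hx using fun n ↦ u.nonempty_of_mem (hA n)
  set G₀ := (Subgroup.closure (range x * (H : Set G))).topologicalClosure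
  have hxG (n : ℕ) (k : G) (hk : k ∈ H) : x n * k ∈ G₀ :=
    Subgroup.le_topologicalClosure _ (Subgroup.subset_closure (mul_mem_mul (mem_range_self n) hk))
  -- `G₀` need not belong to `u`, but `(x n)⁻¹ * a ∈ H * O⁻¹` puts `a` close to a point of `x n *
  -- H`; thickening absorbs the error.
  have hne : NeBot (comap ((↑) : G₀ → G) ((u : Filter G) * 𝓝 1)) := by
    refine comap_neBot fun t ht ↦ ?_
    obtain ⟨B, hB, P, hP, hBP⟩ := Filter.mem_mul.1 ht
    obtain ⟨O, hOP, hO, h1⟩ := mem_nhds_iff.1 hP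
    obtain ⟨n, hn⟩ := hU ((H : Set G) * O⁻¹) hO.inv.mul_left
      fun k hk ↦ ⟨k, hk, 1, by simpa using h1, mul_one k⟩
    obtain ⟨a, haB, haA⟩ := u.nonempty_of_mem (inter_mem hB (hA n))
    obtain ⟨k, hk, p, hp, hkp⟩ := hn (hAU n _ (hx n) a haA).1
    refine ⟨⟨x n * k, hxG n k hk⟩, hBP ⟨a, haB, p⁻¹, hOP hp, ?_⟩⟩
    simp only at hkp ⊢
    rw [mul_inv_eq_iff_eq_mul, mul_assoc, hkp, mul_inv_cancel_left]
  have hv := Ultrafilter.of_le (comap ((↑) : G₀ → G) ((u : Filter G) * 𝓝 1))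
  generalize Ultrafilter.of (comap ((↑) : G₀ → G) ((u : Filter G) * 𝓝 1)) = v at hv
  have hvu : map ((↑) : G₀ → G) v ≤ (u : Filter G) * 𝓝 1 := map_le_iff_le_comap.2 hv
  have hvC : IsRaikovCauchy (v : Filter G₀) := by
    intro V hV
    rw [nhds_subtype_eq_comap] at hV
    obtain ⟨W, hW, hWV⟩ := mem_comap.1 hV
    obtain ⟨B, hB, hBW⟩ := hu.mul_nhds_one W hW
    refine ⟨_, hv (preimage_mem_comap hB), fun a ha b hb ↦ ?_⟩
    exact ⟨hWV (hBW a ha b hb).1, hWV (hBW a ha b hb).2⟩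
  obtain ⟨y, hy⟩ := (h _ (countable_range x)).exists_le_nhds_of_isRaikovCauchy hvC
  have hvy : Tendsto ((↑) : G₀ → G) v (𝓝 (y : G)) :=
    continuous_subtype_val.continuousAt.mono_left hy
  refine ⟨y, fun V hV ↦ ?_⟩
  -- With `z = b q` near `y`, the decomposition is `a = y (y⁻¹ z) q⁻¹ (b⁻¹ a)`.
  have hc : (fun p : G × G × G ↦ (y : G) * p.1 * p.2.1⁻¹ * p.2.2) ⁻¹' V ∈
      𝓝 ((1 : G), (1 : G), (1 : G)) :=
    ContinuousAt.preimage_mem_nhds (by fun_prop) (by simpa using hV)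
  simp only [nhds_prod_eq] at hc
  obtain ⟨P, hP, R, hR, hPR⟩ := mem_prod_iff.1 hc
  obtain ⟨Q, hQ, S, hS, hQS⟩ := mem_prod_iff.1 hR
  obtain ⟨B, hB, hBS⟩ := hu S hS
  have hyP : ((y : G)⁻¹ * ·) ⁻¹' P ∈ 𝓝 (y : G) :=
    (continuous_const_mul _).continuousAt.preimage_mem_nhds (by rwa [inv_mul_cancel])
  obtain ⟨z, hzP, hz⟩ := v.nonempty_of_mem
    (inter_mem (hvy hyP) (hvu (mul_mem_mul hB hQ)))
  obtain ⟨b, hb, q, hq, hbq⟩ := hz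
  refine mem_of_superset hB fun a ha ↦ ?_
  have := hPR (mk_mem_prod hzP (hQS (mk_mem_prod hq (hBS b hb a ha).1)))
  simp only at hbq
  simpa [mul_assoc, ← hbq] using this

/-- The subgroup generated by a `σ`-compact set is `σ`-compact. -/
theorem IsSigmaCompact.subgroup_closure {S : Set G} (hS : IsSigmaCompact S) :
    IsSigmaCompact (Subgroup.closure S : Set G) := by
  have hmul {s t : Set G} (hs : IsSigmaCompact s) (ht : IsSigmaCompact t) :
      IsSigmaCompact (s * t) := by
    obtain ⟨K, hK, rfl⟩ := hs
    obtain ⟨L, hL, rfl⟩ := ht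
    rw [iUnion_mul]
    refine isSigmaCompact_iUnion _ fun m ↦ ?_
    rw [mul_iUnion]
    exact isSigmaCompact_iUnion _ fun n ↦ ((hK m).mul (hL n)).isSigmaCompact
  have hT : IsSigmaCompact (S ∪ S⁻¹) := by
    rw [union_eq_iUnion]
    refine isSigmaCompact_iUnion _ fun b ↦ ?_
    cases b
    · simpa using hS.image continuous_inv
    · exact hS
  have hpow (n : ℕ) : IsSigmaCompact ((S ∪ S⁻¹) ^ n) := by
    induction n with
    | zero => simpa [← singleton_one] using (isCompact_singleton (x := (1 : G))).isSigmaCompact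
    | succ n ih => rw [pow_succ]; exact hmul ih hT
  have heq : (Subgroup.closure S : Set G) = ⋃ n : ℕ, (S ∪ S⁻¹) ^ n := by
    apply Subset.antisymm
    · intro x hx
      have hx' : x ∈ Submonoid.closure (S ∪ S⁻¹) := by
        rwa [← Subgroup.closure_toSubmonoid]
      induction hx' using Submonoid.closure_induction_left with
      | one => exact mem_iUnion.2 ⟨0, by simp⟩
      | mul_left a ha b hb ih =>
        obtain ⟨n, hn⟩ := mem_iUnion.1 (ih (by
          rwa [← Subgroup.closure_toSubmonoid] at hb))
        exact mem_iUnion.2 ⟨n + 1, by rw [pow_succ']; exact mul_mem_mul ha hn⟩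
    · refine iUnion_subset fun n ↦ ?_
      induction n with
      | zero => simp [(Subgroup.closure S).one_mem]
      | succ n ih =>
        rw [pow_succ]
        rintro _ ⟨a, ha, b, hb, rfl⟩
        refine (Subgroup.closure S).mul_mem (ih ha) ?_
        rcases hb with hb | hb
        · exact Subgroup.subset_closure hb
        · exact (Subgroup.closure S).inv_mem_iff.1 (Subgroup.subset_closure hb)
  rw [heq]
  exact isSigmaCompact_iUnion _ hpow

/-! ### Compact subgroups of feathered groups -/

/-- A feathered group has a compact subgroup of countable character. -/
theorem IsFeathered.exists_subgroup [T2Space G] (hG : IsFeathered G) :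
    ∃ H : Subgroup G, IsCompact (H : Set G) ∧ HasCountableOuterBase (H : Set G) := by
  obtain ⟨K, ⟨k, hk⟩, hK, hKb⟩ := hG
  obtain ⟨U, hUo, hKU, hU⟩ := hKb.exists_nat
  have step (W : Set G) (hW : W ∈ 𝓝 (1 : G)) :
      ∃ O, (IsOpen O ∧ (1 : G) ∈ O) ∧ ∀ a ∈ O, ∀ b ∈ O, a⁻¹ * b ∈ W := by
    obtain ⟨O, hO, h1, hOW⟩ := exists_mem_nhds_one_inv_mul_subset hW
    exact ⟨O, ⟨hO, h1⟩, fun a ha b hb ↦ (hOW a ha b hb).1⟩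
  have hkU (n : ℕ) : (k * ·) ⁻¹' U n ∈ 𝓝 (1 : G) :=
    (continuous_const_mul k).continuousAt.preimage_mem_nhds
      ((hUo n).mem_nhds (hKU n (by simpa using hk)))
  choose! φ hφo hφ using step
  -- Each `V (n + 1)` has its quotients `a⁻¹ * b` in `V n`, making the intersection a subgroup, and
  -- `V n` also lies in the translate of `U n`.
  let V : ℕ → Set G := fun n ↦ n.rec (φ ((k * ·) ⁻¹' U 0)) fun n W ↦ φ (W ∩ (k * ·) ⁻¹' U (n + 1))
  have hVo (n : ℕ) : IsOpen (V n) ∧ (1 : G) ∈ V n := by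
    induction n with
    | zero => exact hφo _ (hkU 0)
    | succ n ih => exact hφo _ (inter_mem (ih.1.mem_nhds ih.2) (hkU (n + 1)))
  have hVs (n : ℕ) : ∀ a ∈ V (n + 1), ∀ b ∈ V (n + 1), a⁻¹ * b ∈ V n ∩ (k * ·) ⁻¹' U (n + 1) :=
    hφ _ (inter_mem ((hVo n).1.mem_nhds (hVo n).2) (hkU (n + 1)))
  have hVV (n : ℕ) : V (n + 1) ⊆ V n ∩ (k * ·) ⁻¹' U (n + 1) := fun a ha ↦ by
    simpa using hVs n 1 (hVo (n + 1)).2 a ha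
  have hVU (n : ℕ) : V n ⊆ (k * ·) ⁻¹' U n := by
    cases n with
    | zero => exact fun a ha ↦ by simpa using hφ _ (hkU 0) 1 (hVo 0).2 a ha
    | succ n => exact (hVV n).trans inter_subset_right
  have hanti : Antitone V := antitone_nat_of_succ_le fun n ↦ (hVV n).trans inter_subset_left
  have hinv (n : ℕ) : ∀ a ∈ V (n + 1), a⁻¹ ∈ V n := fun a ha ↦ by
    simpa using (hVs n a ha 1 (hVo (n + 1)).2).1
  have hmul (n : ℕ) : ∀ a ∈ V (n + 2), ∀ b ∈ V (n + 2), a * b ∈ V n := fun a ha b hb ↦ by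
    simpa using (hVs n _ (hinv (n + 1) a ha) b (hanti (Nat.le_succ (n + 1)) hb)).1
  have hcl (n : ℕ) : closure (V (n + 2)) ⊆ V n := by
    intro x hx
    have hopen : IsOpen ((fun y ↦ y⁻¹ * x) ⁻¹' V (n + 2)) := (hVo (n + 2)).1.preimage (by fun_prop)
    obtain ⟨y, hy, hyV⟩ := mem_closure_iff.1 hx _ hopen (by simpa using (hVo (n + 2)).2)
    simpa using hmul n y hyV _ hy
  let H : Subgroup G :=
    { carrier := ⋂ n, V n
      one_mem' := mem_iInter.2 fun n ↦ (hVo n).2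
      mul_mem' := fun ha hb ↦ mem_iInter.2 fun n ↦
        hmul n _ (mem_iInter.1 ha (n + 2)) _ (mem_iInter.1 hb (n + 2))
      inv_mem' := fun ha ↦ mem_iInter.2 fun n ↦ hinv n _ (mem_iInter.1 ha (n + 1)) }
  have hH : (H : Set G) = ⋂ n, V n := rfl
  have hHcl : (H : Set G) = ⋂ n, closure (V n) := by
    rw [hH]
    exact Subset.antisymm (iInter_mono fun n ↦ subset_closure)
      fun x hx ↦ mem_iInter.2 fun n ↦ hcl n (mem_iInter.1 hx (n + 2))
  let L : Set G := (k * ·) ⁻¹' K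
  have hL : IsCompact L := (Homeomorph.mulLeft k).isCompact_preimage.2 hK
  have hLU (O : Set G) (hO : IsOpen O) (hLO : L ⊆ O) : ∃ n, V n ⊆ O := by
    obtain ⟨n, hn⟩ := hU ((k⁻¹ * ·) ⁻¹' O) (hO.preimage (continuous_const_mul _))
      fun x hx ↦ hLO (by simpa [L] using hx)
    exact ⟨n, fun x hx ↦ by simpa using hn (hVU n hx)⟩
  have hHL : (H : Set G) ⊆ L := by
    intro x hx
    by_contra hxL
    obtain ⟨n, hn⟩ := hLU {x}ᶜ isOpen_compl_singleton fun y hy hyx ↦ hxL (hyx ▸ hy)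
    exact hn (mem_iInter.1 hx n) rfl
  have hHc : IsClosed (H : Set G) := hHcl ▸ isClosed_iInter fun n ↦ isClosed_closure
  refine ⟨H, hL.of_isClosed_subset hHc hHL, hasCountableOuterBase_of_nat (fun n ↦ (hVo n).1)
    (fun n ↦ iInter_subset V n) fun O hO hHO ↦ ?_⟩
  -- Some `closure (V n)` misses the compact set `L \ O`, so `O` and its complement together cover
  -- `L`; a later `V m` lies in that union.
  obtain ⟨n, hn⟩ := (hL.diff hO).elim_directed_family_closed
    (fun n ↦ closure (V n)) (fun n ↦ isClosed_closure)
    (by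
      rw [← hHcl]
      exact eq_empty_of_forall_notMem fun x hx ↦ hx.1.2 (hHO hx.2))
    (directed_of_isDirected_le fun m n hmn ↦ closure_mono (hanti hmn))
  obtain ⟨m, hm⟩ := hLU (O ∪ (closure (V n))ᶜ) (hO.union isClosed_closure.isOpen_compl)
    fun x hx ↦ by
      by_contra hxO
      rw [mem_union, not_or, notMem_compl_iff] at hxO
      exact (hn ▸ (⟨⟨hx, hxO.1⟩, hxO.2⟩ : x ∈ L \ O ∩ closure (V n)) : x ∈ (∅ : Set G))
  refine ⟨max m n, fun x hx ↦ ?_⟩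
  exact (hm (hanti (le_max_left m n) hx)).resolve_right
    fun h ↦ h (subset_closure (hanti (le_max_right m n) hx))

end Groups

theorem mainTheorem11 {G : Type*} [TopologicalSpace G] [Group G] [IsTopologicalGroup G]
    [T2Space G] (hG : IsFeathered G) :
    List.TFAE [
      IsCechComplete G,
      ∀ G₀ : Subgroup G, IsClosed (G₀ : Set G) →
        (∃ F : Set G₀, IsSigmaCompact F ∧ Dense F) → IsCechComplete G₀,
      ∃ H : Subgroup G, IsCompact (H : Set G) ∧ HasCountableOuterBase (H : Set G) ∧
        ∀ Q : Set G, Q.Countable →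
          IsCechComplete (Subgroup.closure (Q * (H : Set G))).topologicalClosure] := by
  tfae_have 1 → 2 := fun h G₀ hG₀ _ ↦ by
    have := t35Space_of_isTopologicalGroup (G := G₀)
    exact (h.hasCompleteCovers.of_isClosedEmbedding hG₀.isClosedEmbedding_subtypeVal).isCechComplete
  tfae_have 2 → 3 := fun h ↦ by
    obtain ⟨H, hH, hHb⟩ := hG.exists_subgroup
    refine ⟨H, hH, hHb, fun Q hQ ↦ ?_⟩
    set C := Subgroup.closure (Q * (H : Set G))
    have himage : ((↑) : C.topologicalClosure → G) '' ((↑) ⁻¹' (C : Set G)) = C :=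
      image_preimage_eq_of_subset fun x hx ↦ ⟨⟨x, C.le_topologicalClosure hx⟩, rfl⟩
    refine h _ (Subgroup.isClosed_topologicalClosure _)
      ⟨(↑) ⁻¹' (C : Set G), ?_, ?_⟩
    · rw [Subtype.isSigmaCompact_iff, himage]
      refine IsSigmaCompact.subgroup_closure ?_
      -- `Q * H` is a countable union of compact cosets.
      rw [← iUnion_mul_left_image]
      exact isSigmaCompact_biUnion hQ fun q _ ↦
        (hH.image (continuous_const_mul q)).isSigmaCompact
    · intro x
      rw [IsInducing.subtypeVal.closure_eq_preimage_closure_image]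
      exact mem_preimage.2 (himage.symm ▸ x.2 : (x : G) ∈ closure _)
  tfae_have 3 → 1 := fun ⟨H, hH, hHb, h⟩ ↦ isCechComplete_of_isRaikovCauchy hH H.one_mem hHb
    fun u hu ↦ exists_le_nhds_of_isCechComplete_closure hHb h hu
  tfae_finish
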